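/- All graphs are finite, undirected and simple. Let $w$ be a word (a finite sequence of letters). Two distinct letters $a,b$ \emph{alternate} in $w$ if deleting all other letters from $w$ leaves a word of the form $(ab)^n$, $(ab)^na$, $(ba)^n$ or $(ba)^nb$ with $n\ge 1$. The word $w$ \emph{represents} a graph $G=(V,E)$ if the set of letters occurring in $w$ is $V$ and, for all distinct $a,b\in V$, $a$ and $b$ alternate in $w$ if and only if $\{a,b\}\in E$. For $k\ge 1$, let $\mathbb{R}^k$ be the class of graphs represented by a word in which every occurring letter occurs exactly $k$ times. A \emph{marking sequence} for $w$ is an enumeration $(a_1,\dots,a_n)$, without repetition, of the letters occurring in $w$; at stage $i\in\{1,\dots,n\}$ all occurrences of $a_1,\dots,a_i$ in $w$ are marked, and a \emph{marked block} is a maximal factor of consecutive marked letters. The word $w$ is \emph{$k$-local} if it has a marking sequence such that there are at most $k$ marked blocks at every stage. Let $\mathcal{L}^k$ be the class of graphs represented by a $k$-local word. \textbf{Theorem.} For every integer $k\ge 1$, $\mathcal{L}^k$ is a proper subclass of $\mathbb{R}^{k+1}$, that is, $\mathcal{L}^k\subsetneq\mathbb{R}^{k+1}$. -/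

import Mathlib

namespace WordGraph

universe u

section Words

variable {α : Type u} [DecidableEq α]

/-- The projection of the word `w` onto the two letters `a` and `b`. -/
def proj (w : List α) (a b : α) : List α :=
  w.filter (fun x => x = a ∨ x = b)

/-- The power `u ^ n` of a word `u`. -/
def wordPow (u : List α) (n : ℕ) : List α :=
  (List.replicate n u).flatten

/-- Two distinct letters `a`, `b` alternate in `w` if the projection of `w` onto `{a, b}` is
`(ab)^n`, `(ab)^n a`, `(ba)^n` or `(ba)^n b` for some `n ≥ 1`. -/
def Alternate (w : List α) (a b : α) : Prop :=
  a ≠ b ∧ ∃ n : ℕ, 1 ≤ n ∧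
    (proj w a b = wordPow [a, b] n ∨ proj w a b = wordPow [a, b] n ++ [a] ∨
      proj w a b = wordPow [b, a] n ∨ proj w a b = wordPow [b, a] n ++ [b])

/-- The word `w` represents the graph `G`: the letters occurring in `w` are exactly the nodes, and
two nodes are adjacent iff they alternate in `w`. -/
def Represents (w : List α) (G : SimpleGraph α) : Prop :=
  (∀ v : α, v ∈ w) ∧ ∀ a b : α, Alternate w a b ↔ G.Adj a b

/-- Every letter of `w` occurs exactly `k` times in `w`. -/
def IsUniform (k : ℕ) (w : List α) : Prop :=
  ∀ a ∈ w, w.count a = k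

/-- A marking sequence of `w`: an enumeration without repetition of the letters of `w`. -/
def IsMarkingSequence (σ : List α) (w : List α) : Prop :=
  σ.Nodup ∧ ∀ a : α, a ∈ σ ↔ a ∈ w

/-- The marked version of `w` at stage `i`: every letter is paired with a Boolean that is `true`
(the letter is marked) iff it is among the first `i` letters of `σ`. -/
def markedVersion (σ : List α) (w : List α) (i : ℕ) : List (α × Bool) :=
  w.map (fun a => (a, decide (a ∈ σ.take i)))

/-- The letter at position `j` (counted from `0`) exists and is marked. -/
def MarkedAt {α : Type u} (m : List (α × Bool)) (j : ℕ) : Prop :=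
  ∃ a : α, m[j]? = some (a, true)

/-- The factor of `m` at the positions `p, …, q` is a marked block: it is nonempty, all its letters
are marked, and it cannot be extended to the left or to the right by a marked letter. -/
def IsMarkedBlock {α : Type u} (m : List (α × Bool)) (p q : ℕ) : Prop :=
  p ≤ q ∧ (∀ j, p ≤ j → j ≤ q → MarkedAt m j) ∧
    (∀ j, j + 1 = p → ¬ MarkedAt m j) ∧ ¬ MarkedAt m (q + 1)

/-- The set of (positions of) marked blocks of `m`. -/
def markedBlocks {α : Type u} (m : List (α × Bool)) : Set (ℕ × ℕ) :=
  {b | IsMarkedBlock m b.1 b.2}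

/-- There are only finitely many marked blocks, so that `Set.ncard` counts them. -/
theorem markedBlocks_finite {α : Type u} (m : List (α × Bool)) : (markedBlocks m).Finite := by
  refine ((Set.finite_Iio m.length).prod (Set.finite_Iio m.length)).subset ?_
  rintro ⟨p, q⟩ ⟨hpq, h, -, -⟩
  have key : ∀ j, MarkedAt m j → j < m.length := by
    rintro j ⟨a, ha⟩
    exact (List.getElem?_eq_some_iff.mp ha).1
  exact ⟨key p (h p le_rfl hpq), key q (h q hpq le_rfl)⟩

/-- The word `w` is `k`-local: for some marking sequence `σ`, the marked version of `w` has at most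
`k` marked blocks at every stage. -/
def IsLocal (k : ℕ) (w : List α) : Prop :=
  ∃ σ : List α, IsMarkingSequence σ w ∧
    ∀ i : ℕ, 1 ≤ i → i ≤ σ.length → (markedBlocks (markedVersion σ w i)).ncard ≤ k

end Words

/-- A finite undirected graph (without loops and multiple edges). -/
structure FinGraph where
  V : Type u
  finite : Finite V
  graph : SimpleGraph V

open Classical in
/-- The class `R^k` of `k`-representable graphs. -/
def RepClass (k : ℕ) : Set FinGraph.{u} :=
  {G | ∃ w : List G.V, IsUniform k w ∧ Represents w G.graph}

open Classical in
/-- The class `L^k` of graphs that are represented by a `k`-local word. -/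
def LocClass (k : ℕ) : Set FinGraph.{u} :=
  {G | ∃ w : List G.V, IsLocal k w ∧ Represents w G.graph}

end WordGraph

/-! Inclusion. Let `a` and `b` alternate in a `k`-local word, with `a` marked first. At the stage
that marks `a`, a still unmarked `b` lies between any two `a`s, so no block holds two of them: `a`
occurs at most `k` times and `b` at most `k + 1` times (`count_le_of_isLocal`). Isolated nodes are
not bounded this way, but each can be replaced by a square at the end of the word
(`exists_represents_count_le`). Appending deficient letters in a suitable order then makes the word
`(k + 1)`-uniform (`exists_uniform_of_count_le`).

Properness. Join two leaves of a complete ternary tree when they branch at an even depth. Two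
traversals of the tree, one reversing direction at odd depths, represent this graph, so it lies in
every `RepClass k` with `k ≥ 2`. For any marking order some leaf `p` has, at each depth, both an
earlier and a later leaf branching off from it (`exists_leaf_between`). When `p` is marked, marked
leaves `x i` chosen at depths `2 * i` and unmarked leaves `y j` at depths `2 * j + 1` form a half
graph: `x i` is adjacent to `y j` iff `i ≤ j`. With at most `k` blocks there are at most `2 ^ k`
sets of blocks that an `x i` can meet, and two of the `x i` meeting the same blocks would contradict
the half graph (`alternate_of_blocksOf_eq`). -/

namespace WordGraph

universe u

/-! ### Separation of occurrences, by positions. -/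

section Positions

variable {α : Type u}

/-- Between any two occurrences of `a` in `w` there is an occurrence of `b`. -/
def Separates (w : List α) (a b : α) : Prop :=
  ∀ x y : ℕ, x < y → w[x]? = some a → w[y]? = some a →
    ∃ z : ℕ, x < z ∧ z < y ∧ w[z]? = some b

/-- Before each occurrence of `a` in `w` there is an occurrence of `b`. -/
def Precedes (w : List α) (a b : α) : Prop :=
  ∀ y : ℕ, w[y]? = some a → ∃ z : ℕ, z < y ∧ w[z]? = some b

theorem separates_nil (a b : α) : Separates ([] : List α) a b := by
  intro x y _ h; simp at h

theorem precedes_cons_of_ne {c a b : α} {w : List α} (hca : c ≠ a) :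
    Precedes (c :: w) a b ↔ c = b ∨ Precedes w a b := by
  constructor
  · intro h
    by_cases hcb : c = b
    · exact .inl hcb
    · refine .inr fun y hy => ?_
      obtain ⟨z, hz, hzb⟩ := h (y + 1) (by simpa using hy)
      cases z with
      | zero => exact absurd (by simpa using hzb) hcb
      | succ z => exact ⟨z, by omega, by simpa using hzb⟩
  · rintro (rfl | h) y hy
    · cases y with
      | zero => exact absurd (by simpa using hy) hca
      | succ y => exact ⟨0, by omega, by simp⟩
    · cases y with
      | zero => exact absurd (by simpa using hy) hca
      | succ y =>
        obtain ⟨z, hz, hzb⟩ := h y (by simpa using hy)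
        exact ⟨z + 1, by omega, by simpa using hzb⟩

theorem separates_cons_self {a b : α} {w : List α} :
    Separates (a :: w) a b ↔ Precedes w a b ∧ Separates w a b := by
  constructor
  · intro h
    refine ⟨fun y hy => ?_, fun x y hxy hx hy => ?_⟩
    · obtain ⟨z, h1, h2, h3⟩ := h 0 (y + 1) (by omega) (by simp) (by simpa using hy)
      obtain ⟨z, rfl⟩ : ∃ t, z = t + 1 := ⟨z - 1, by omega⟩
      exact ⟨z, by omega, by simpa using h3⟩
    · obtain ⟨z, h1, h2, h3⟩ := h (x + 1) (y + 1) (by omega) (by simpa using hx) (by simpa using hy)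
      obtain ⟨z, rfl⟩ : ∃ t, z = t + 1 := ⟨z - 1, by omega⟩
      exact ⟨z, by omega, by omega, by simpa using h3⟩
  · rintro ⟨hp, hs⟩ x y hxy hx hy
    obtain ⟨y, rfl⟩ : ∃ t, y = t + 1 := ⟨y - 1, by omega⟩
    cases x with
    | zero =>
      obtain ⟨z, hz, hzb⟩ := hp y (by simpa using hy)
      exact ⟨z + 1, by omega, by omega, by simpa using hzb⟩
    | succ x =>
      obtain ⟨z, h1, h2, h3⟩ := hs x y (by omega) (by simpa using hx) (by simpa using hy)
      exact ⟨z + 1, by omega, by omega, by simpa using h3⟩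

theorem separates_cons_of_ne {c a b : α} {w : List α} (hca : c ≠ a) :
    Separates (c :: w) a b ↔ Separates w a b := by
  constructor
  · intro h x y hxy hx hy
    obtain ⟨z, h1, h2, h3⟩ := h (x + 1) (y + 1) (by omega) (by simpa using hx) (by simpa using hy)
    obtain ⟨z, rfl⟩ : ∃ t, z = t + 1 := ⟨z - 1, by omega⟩
    exact ⟨z, by omega, by omega, by simpa using h3⟩
  · intro hs x y hxy hx hy
    obtain ⟨y, rfl⟩ : ∃ t, y = t + 1 := ⟨y - 1, by omega⟩
    cases x with
    | zero => exact absurd (by simpa using hx) hca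
    | succ x =>
      obtain ⟨z, h1, h2, h3⟩ := hs x y (by omega) (by simpa using hx) (by simpa using hy)
      exact ⟨z + 1, by omega, by omega, by simpa using h3⟩

theorem not_precedes_cons_self {a b : α} {w : List α} : ¬ Precedes (a :: w) a b := by
  intro h
  obtain ⟨z, hz, _⟩ := h 0 (by simp)
  omega

theorem getElem?_concat_eq_some {w : List α} {c a : α} {x : ℕ} :
    (w ++ [c])[x]? = some a ↔ w[x]? = some a ∨ x = w.length ∧ c = a := by
  rw [List.getElem?_append]
  grind

theorem lt_length_of_getElem? {w : List α} {a : α} {x : ℕ} (h : w[x]? = some a) :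
    x < w.length := (List.getElem?_eq_some_iff.1 h).1

theorem separates_concat_of_ne {w : List α} {a b c : α} (hs : Separates w a b) (hca : c ≠ a) :
    Separates (w ++ [c]) a b := by
  intro x y hxy hx hy
  simp only [getElem?_concat_eq_some, hca, and_false, or_false] at hx hy ⊢
  obtain ⟨z, h1, h2, h3⟩ := hs x y hxy hx hy
  exact ⟨z, h1, h2, .inl h3⟩

end Positions

/-! ### Powers of two-letter words and words without equal neighbours. -/

section Powers

variable {α : Type u}

theorem wordPow_succ (v : List α) (n : ℕ) : wordPow v (n + 1) = v ++ wordPow v n := by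
  simp [wordPow, List.replicate_succ]

theorem cons_wordPow (a b : α) (n : ℕ) :
    a :: wordPow [b, a] n = wordPow [a, b] n ++ [a] := by
  induction n with
  | zero => simp [wordPow]
  | succ n ih =>
    rw [wordPow_succ, wordPow_succ]
    simpa using ih

theorem isChain_wordPow {a b : α} (hab : a ≠ b) (n : ℕ) :
    (wordPow [a, b] n ++ [a]).IsChain (· ≠ ·) := by
  induction n with
  | zero => simp [wordPow]
  | succ n ih =>
    rw [wordPow_succ]
    cases n with
    | zero => simp [wordPow, hab, hab.symm]
    | succ n =>
      rw [wordPow_succ] at ih ⊢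
      simp only [List.cons_append, List.nil_append, List.isChain_cons_cons] at ih ⊢
      exact ⟨hab, hab.symm, ih⟩

theorem exists_wordPow_of_isChain (l : List α) : ∀ a b : α, (∀ x ∈ l, x = a ∨ x = b) →
    (a :: l).IsChain (· ≠ ·) →
    ∃ n, a :: l = wordPow [a, b] (n + 1) ∨ a :: l = wordPow [a, b] n ++ [a] := by
  induction l with
  | nil => exact fun a b _ _ => ⟨0, .inr (by simp [wordPow])⟩
  | cons c l ih =>
    intro a b hl hc
    rw [List.isChain_cons_cons] at hc
    obtain rfl : c = b := (hl c (by simp)).resolve_left (Ne.symm hc.1)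
    obtain ⟨n, h | h⟩ := ih c a (fun x hx => (hl x (by simp [hx])).symm) hc.2
    · exact ⟨n + 1, .inr (by rw [h, cons_wordPow])⟩
    · exact ⟨n, .inl (by rw [h, wordPow_succ, ← cons_wordPow]; rfl)⟩

end Powers

/-! ### Equivalent forms of alternation. -/

section Alternation

variable {α : Type u} [DecidableEq α]

theorem proj_comm (w : List α) (a b : α) : proj w a b = proj w b a := by
  simp only [proj, or_comm]

theorem proj_append (v w : List α) (a b : α) : proj (v ++ w) a b = proj v a b ++ proj w a b := by
  simp [proj]

theorem mem_proj {w : List α} {a b x : α} : x ∈ proj w a b ↔ x ∈ w ∧ (x = a ∨ x = b) := by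
  simp [proj]

theorem precedes_iff_head {a b : α} (hab : a ≠ b) (w : List α) :
    Precedes w a b ↔ ∀ y ∈ (proj w a b).head?, a ≠ y := by
  induction w with
  | nil => simp [Precedes, proj]
  | cons c w ih =>
    by_cases hca : c = a
    · subst hca
      simp [not_precedes_cons_self, proj]
    · rw [precedes_cons_of_ne hca]
      by_cases hcb : c = b
      · subst hcb
        simp [proj, hab]
      · rw [ih]
        simp [proj, hca, hcb]

/-- A new first letter `a` adds one demand to either side: the rest of the projection must not begin
with `a`, which is `Precedes`. -/
theorem separates_iff_isChain {a b : α} (hab : a ≠ b) (w : List α) :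
    (Separates w a b ∧ Separates w b a) ↔ (proj w a b).IsChain (· ≠ ·) := by
  induction w with
  | nil => simp [separates_nil, proj]
  | cons c w ih =>
    by_cases hca : c = a
    · subst hca
      have : proj (c :: w) c b = c :: proj w c b := by simp [proj]
      rw [this, List.isChain_cons, ← ih, separates_cons_self, separates_cons_of_ne hab,
        precedes_iff_head hab]
      tauto
    · by_cases hcb : c = b
      · subst hcb
        have : proj (c :: w) a c = c :: proj w a c := by simp [proj]
        rw [this, List.isChain_cons, ← ih, separates_cons_self, separates_cons_of_ne hab.symm,
          precedes_iff_head hab.symm, proj_comm w c a]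
        tauto
      · have : proj (c :: w) a b = proj w a b := by simp [proj, hca, hcb]
        rw [this, ← ih, separates_cons_of_ne hca, separates_cons_of_ne hcb]

/-- The four shapes are exactly the two-letter words without equal neighbours; the bound `1 ≤ n`
corresponds to both letters occurring. -/
theorem alternate_iff_isChain {w : List α} {a b : α} :
    Alternate w a b ↔ a ≠ b ∧ a ∈ w ∧ b ∈ w ∧ (proj w a b).IsChain (· ≠ ·) := by
  constructor
  · rintro ⟨hab, n, hn, h⟩
    obtain ⟨n, rfl⟩ : ∃ t, n = t + 1 := ⟨n - 1, by omega⟩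
    have key : (a ∈ proj w a b ∧ b ∈ proj w a b) ∧ (proj w a b).IsChain (· ≠ ·) := by
      rcases h with h | h | h | h <;> rw [h] <;> refine ⟨by simp [wordPow_succ], ?_⟩
      · exact (isChain_wordPow hab _).left_of_append
      · exact isChain_wordPow hab _
      · exact (isChain_wordPow hab.symm _).left_of_append
      · exact isChain_wordPow hab.symm _
    exact ⟨hab, (mem_proj.1 key.1.1).1, (mem_proj.1 key.1.2).1, key.2⟩
  · rintro ⟨hab, ha, hb, hc⟩
    refine ⟨hab, ?_⟩
    have ha' : a ∈ proj w a b := mem_proj.2 ⟨ha, .inl rfl⟩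
    have hb' : b ∈ proj w a b := mem_proj.2 ⟨hb, .inr rfl⟩
    have hmem : ∀ x ∈ proj w a b, x = a ∨ x = b := fun x hx => (mem_proj.1 hx).2
    generalize proj w a b = l at *
    cases l with
    | nil => simp at ha'
    | cons c l =>
      have hl : ∀ x ∈ l, x = a ∨ x = b := fun x hx => hmem x (by simp [hx])
      rcases hmem c (by simp) with rfl | rfl
      · obtain ⟨n, h | h⟩ := exists_wordPow_of_isChain l c b hl hc
        · exact ⟨n + 1, by omega, .inl h⟩
        · refine ⟨n, Nat.one_le_iff_ne_zero.2 ?_, .inr (.inl h)⟩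
          rintro rfl
          rw [h] at hb'
          simp [wordPow, hab.symm] at hb'
      · obtain ⟨n, h | h⟩ := exists_wordPow_of_isChain l c a (fun x hx => (hl x hx).symm) hc
        · exact ⟨n + 1, by omega, .inr (.inr (.inl h))⟩
        · refine ⟨n, Nat.one_le_iff_ne_zero.2 ?_, .inr (.inr (.inr h))⟩
          rintro rfl
          rw [h] at ha'
          simp [wordPow, hab] at ha'

theorem alternate_iff {w : List α} {a b : α} :
    Alternate w a b ↔ a ≠ b ∧ a ∈ w ∧ b ∈ w ∧ Separates w a b ∧ Separates w b a := by
  rw [alternate_iff_isChain]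
  constructor
  · rintro ⟨h, ha, hb, hc⟩
    exact ⟨h, ha, hb, (separates_iff_isChain h w).2 hc⟩
  · rintro ⟨h, ha, hb, hc⟩
    exact ⟨h, ha, hb, (separates_iff_isChain h w).1 hc⟩

theorem Alternate.symm {w : List α} {a b : α} (h : Alternate w a b) : Alternate w b a := by
  rw [alternate_iff] at *
  tauto

end Alternation

/-! ### Occurrence counts and extension to a uniform word. -/

section Counting

variable {α : Type u} [DecidableEq α]

/-- The positions of the letter `a` in `w`. -/
def positions (w : List α) (a : α) : Finset ℕ :=
  (Finset.range w.length).filter (fun x => w[x]? = some a)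

theorem mem_positions {w : List α} {a : α} {x : ℕ} : x ∈ positions w a ↔ w[x]? = some a := by
  simp only [positions, Finset.mem_filter, Finset.mem_range, and_iff_right_iff_imp]
  exact fun h => (List.getElem?_eq_some_iff.1 h).1

theorem card_positions (w : List α) (a : α) : (positions w a).card = w.count a := by
  induction w using List.reverseRecOn with
  | nil => simp [positions]
  | append_singleton w c ih =>
    have hw : w.length ∉ positions w a := by simp [positions]
    by_cases hc : c = a
    · subst hc
      have : positions (w ++ [c]) c = insert w.length (positions w c) := by
        ext x
        simp only [Finset.mem_insert, mem_positions, List.getElem?_append]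
        grind
      rw [this, Finset.card_insert_of_notMem hw, ih]
      simp
    · have : positions (w ++ [c]) a = positions w a := by
        ext x
        simp only [mem_positions, List.getElem?_append]
        grind
      rw [this, ih]
      simp [hc]

/-- Sending each `b` to the next `a` is injective, since an `a` lies between any two `b`s. -/
theorem count_le_of_separates {w : List α} {a b : α} (hs : Separates w b a)
    (hlast : ∀ x : ℕ, w[x]? = some b → ∃ y : ℕ, x < y ∧ w[y]? = some a) : w.count b ≤ w.count a := by
  rw [← card_positions, ← card_positions]
  classical
  let g : ℕ → ℕ := fun x => if h : ∃ y : ℕ, x < y ∧ w[y]? = some a then Nat.find h else 0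
  have hg : ∀ x, w[x]? = some b → x < g x ∧ w[g x]? = some a := by
    intro x hx
    simp only [g, dif_pos (hlast x hx)]
    exact Nat.find_spec (hlast x hx)
  have hmin : ∀ x z, x < z → w[z]? = some a → g x ≤ z := by
    intro x z hxz hz
    have h : ∃ y : ℕ, x < y ∧ w[y]? = some a := ⟨z, hxz, hz⟩
    simp only [g, dif_pos h]
    exact Nat.find_min' h ⟨hxz, hz⟩
  have hlt : ∀ x y : ℕ, x < y → w[x]? = some b → w[y]? = some b → g x ≠ g y := by
    intro x y hxy hx hy
    obtain ⟨z, h1, h2, h3⟩ := hs x y hxy hx hy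
    have := hmin x z h1 h3
    have := (hg y hy).1
    omega
  refine Finset.card_le_card_of_injOn g (fun x hx => ?_) (fun x hx y hy hxy => ?_)
  · simp only [Finset.mem_coe, mem_positions] at *
    exact (hg x hx).2
  · simp only [Finset.mem_coe, mem_positions] at *
    by_contra hne
    rcases lt_or_gt_of_ne hne with h | h
    · exact hlt x y h hx hy hxy
    · exact hlt y x h hy hx hxy.symm

theorem count_le_succ_of_separates {w : List α} {a b : α} (hab : a ≠ b) (hs : Separates w b a) :
    w.count b ≤ w.count a + 1 := by
  -- One extra `a` at the end ensures that every `b` is followed by an `a`.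
  have h := count_le_of_separates (separates_concat_of_ne (c := a) hs hab) (fun x hx => ?_)
  · simpa [hab] using h
  · simp only [getElem?_concat_eq_some, hab, and_false, or_false] at hx
    exact ⟨w.length, lt_length_of_getElem? hx, by simp⟩

theorem alternate_concat_iff {w : List α} {a b c : α} (hca : c ≠ a) (hcb : c ≠ b) :
    Alternate (w ++ [c]) a b ↔ Alternate w a b := by
  have : proj (w ++ [c]) a b = proj w a b := by simp [proj, hca, hcb]
  simp only [Alternate, this]

theorem alternate_concat_self_iff {w : List α} {a b : α} (ha : a ∈ w) (hb : b ∈ w)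
    (h : Alternate w a b → ∀ x : ℕ, w[x]? = some a → ∃ y : ℕ, x < y ∧ w[y]? = some b) :
    Alternate (w ++ [a]) a b ↔ Alternate w a b := by
  constructor
  · rw [alternate_iff_isChain, alternate_iff_isChain, proj_append]
    rintro ⟨hab, -, -, hc⟩
    exact ⟨hab, ha, hb, hc.left_of_append⟩
  · intro hw
    have hl := h hw
    rw [alternate_iff] at hw ⊢
    obtain ⟨hab, -, -, h1, h2⟩ := hw
    refine ⟨hab, by simp, by simp [hb], ?_, separates_concat_of_ne h2 hab⟩
    intro x y hxy hx hy
    simp only [getElem?_concat_eq_some, and_true] at hx hy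
    have hx' : w[x]? = some a := by
      rcases hx with hx | rfl
      · exact hx
      · rcases hy with hy | rfl
        · have := lt_length_of_getElem? hy
          omega
        · omega
    rcases hy with hy | rfl
    · obtain ⟨z, h3, h4, h5⟩ := h1 x y hxy hx' hy
      exact ⟨z, h3, h4, getElem?_concat_eq_some.2 (.inl h5)⟩
    · obtain ⟨z, h3, h4⟩ := hl x hx'
      exact ⟨z, h3, lt_length_of_getElem? h4, getElem?_concat_eq_some.2 (.inl h4)⟩

/-- A deficient letter whose last occurrence comes first can be appended. -/
theorem exists_represents_concat {w : List α} {G : SimpleGraph α} {m : ℕ} (hw : Represents w G)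
    (hm : ∀ a, w.count a ≤ m) (hlt : ∃ a, w.count a < m) :
    ∃ a, w.count a < m ∧ Represents (w ++ [a]) G := by
  classical
  have hlast : ∀ a : α, ∃ x : ℕ, w[x]? = some a ∧ ∀ y : ℕ, w[y]? = some a → y ≤ x := by
    intro a
    have hne : (positions w a).Nonempty := by
      rw [← Finset.card_pos, card_positions, List.count_pos_iff]
      exact hw.1 a
    refine ⟨(positions w a).max' hne, mem_positions.1 (Finset.max'_mem _ hne), fun y hy => ?_⟩
    exact Finset.le_max' _ _ (mem_positions.2 hy)
  choose last hl hmax using hlast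
  obtain ⟨a, ha, hmin⟩ : ∃ a, w.count a < m ∧ ∀ b, w.count b < m → last a ≤ last b := by
    have hne : {a | w.count a < m}.Nonempty := hlt
    exact ⟨Function.argminOn last _ hne, Function.argminOn_mem last _ hne,
      fun b hb => Function.argminOn_le last _ hb⟩
  refine ⟨a, ha, fun v => by simp [hw.1 v], ?_⟩
  have key : ∀ b, Alternate (w ++ [a]) a b ↔ Alternate w a b := by
    intro b
    refine alternate_concat_self_iff (hw.1 a) (hw.1 b) fun hab x hx => ?_
    have hne : last a ≠ last b := by
      intro h
      have := hl a
      rw [h, hl b] at this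
      exact hab.1 (Option.some.inj this).symm
    refine ⟨last b, (hmax a x hx).trans_lt (lt_of_le_of_ne ?_ hne), hl b⟩
    -- A deficient `b` ends no earlier by the choice of `a`. A saturated `b` ending before `a` would
    -- have each occurrence followed by an `a`, so `m = w.count b ≤ w.count a < m`.
    rcases (hm b).lt_or_eq with hb | hb
    · exact hmin b hb
    · by_contra! hlt
      have hc := count_le_of_separates (alternate_iff.1 hab).2.2.2.2
        (fun x hx => ⟨last a, (hmax b x hx).trans_lt hlt, hl a⟩)
      omega
  intro b c
  rw [← hw.2]
  by_cases hb : a = b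
  · subst hb
    exact key c
  · by_cases hc : a = c
    · subst hc
      exact ⟨fun h => ((key b).1 h.symm).symm, fun h => ((key b).2 h.symm).symm⟩
    · exact alternate_concat_iff hb hc

theorem exists_uniform_of_count_le [Finite α] {G : SimpleGraph α} {m : ℕ} {w : List α}
    (hw : Represents w G) (hm : ∀ a, w.count a ≤ m) :
    ∃ v : List α, IsUniform m v ∧ Represents v G := by
  have := Fintype.ofFinite α
  -- The total deficit drops with every appended letter.
  induction hd : (∑ a : α, (m - w.count a)) using Nat.strong_induction_on generalizing w with
  | _ d ih =>
    subst hd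
    by_cases hlt : ∃ a, w.count a < m
    · obtain ⟨a, ha, hr⟩ := exists_represents_concat hw hm hlt
      refine ih _ ?_ hr ?_ rfl
      · refine Finset.sum_lt_sum (fun b _ => ?_) ⟨a, Finset.mem_univ a, ?_⟩
        · rw [List.count_append]
          omega
        · simp only [List.count_append, List.count_singleton_self]
          omega
      · intro b
        rw [List.count_append]
        by_cases hb : a = b
        · subst hb
          simpa using ha
        · simpa [hb] using hm b
    · push Not at hlt
      exact ⟨w, fun a _ => le_antisymm (hm a) (hlt a), hw⟩

end Counting

/-! ### Marked blocks and the letters they contain. -/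

section Blocks

variable {α : Type u}

theorem exists_markedBlock {m : List (α × Bool)} {x : ℕ} (h : MarkedAt m x) :
    ∃ b ∈ markedBlocks m, b.1 ≤ x ∧ x ≤ b.2 := by
  classical
  have hp : ∃ p, p ≤ x ∧ ∀ j, p ≤ j → j ≤ x → MarkedAt m j :=
    ⟨x, le_rfl, fun j h1 h2 => (le_antisymm h1 h2) ▸ h⟩
  have hq : ∃ q, x ≤ q ∧ ¬ MarkedAt m (q + 1) := by
    -- Positions beyond the end of the word are unmarked, so the search to the right terminates.
    refine ⟨max x m.length, le_max_left _ _, ?_⟩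
    rintro ⟨a, ha⟩
    have := (List.getElem?_eq_some_iff.1 ha).1
    have := le_max_right x m.length
    omega
  refine ⟨(Nat.find hp, Nat.find hq), ⟨?_, ?_, ?_, ?_⟩, ?_, ?_⟩
  · exact (Nat.find_spec hp).1.trans (Nat.find_spec hq).1
  · intro j h1 h2
    rcases le_or_gt j x with hj | hj
    · exact (Nat.find_spec hp).2 j h1 hj
    · obtain ⟨j, rfl⟩ : ∃ t, j = t + 1 := ⟨j - 1, by omega⟩
      by_contra hm
      exact Nat.find_min hq (m := j) h2 ⟨by omega, hm⟩
  · intro j hj hm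
    refine Nat.find_min hp (m := j) (by omega) ⟨?_, fun i h1 h2 => ?_⟩
    · have := (Nat.find_spec hp).1
      omega
    · rcases h1.eq_or_lt with rfl | h1
      · exact hm
      · exact (Nat.find_spec hp).2 i (by omega) h2
  · exact (Nat.find_spec hq).2
  · exact (Nat.find_spec hp).1
  · exact (Nat.find_spec hq).1

theorem markedAt_of_mem_markedBlocks {m : List (α × Bool)} {b : ℕ × ℕ} (hb : b ∈ markedBlocks m)
    {z : ℕ} (h1 : b.1 ≤ z) (h2 : z ≤ b.2) : MarkedAt m z :=
  hb.2.1 z h1 h2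

/-- The marked blocks of `m` which contain an occurrence of the letter `a` of `w`. -/
def blocksOf (m : List (α × Bool)) (w : List α) (a : α) : Set (ℕ × ℕ) :=
  {b | b ∈ markedBlocks m ∧ ∃ x : ℕ, b.1 ≤ x ∧ x ≤ b.2 ∧ w[x]? = some a}

variable {m : List (α × Bool)} {w : List α} {k : ℕ}

/-- Two `a`s in one block would enclose an unmarked `b`, so distinct occurrences of `a` lie in
distinct blocks. -/
theorem count_le_of_separates_unmarked [DecidableEq α] {a b : α}
    (hk : (markedBlocks m).ncard ≤ k)
    (ha : ∀ x : ℕ, w[x]? = some a → MarkedAt m x)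
    (hb : ∀ x : ℕ, w[x]? = some b → ¬ MarkedAt m x)
    (hs : Separates w a b) : w.count a ≤ k := by
  classical
  refine le_trans ?_ hk
  rw [← card_positions, Set.ncard_eq_toFinset_card _ (markedBlocks_finite m)]
  have hex : ∀ x : ℕ, ∃ b : ℕ × ℕ, w[x]? = some a → b ∈ markedBlocks m ∧ b.1 ≤ x ∧ x ≤ b.2 := by
    intro x
    by_cases hx : w[x]? = some a
    · obtain ⟨b, h1, h2, h3⟩ := exists_markedBlock (ha x hx)
      exact ⟨b, fun _ => ⟨h1, h2, h3⟩⟩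
    · exact ⟨(0, 0), fun h => absurd h hx⟩
  choose f hf using hex
  have hlt : ∀ x y, x < y → w[x]? = some a → w[y]? = some a → f x ≠ f y := by
    intro x y hxy hx hy hfe
    obtain ⟨z, h1, h2, h3⟩ := hs x y hxy hx hy
    obtain ⟨hfx, hfx1, hfx2⟩ := hf x hx
    obtain ⟨-, -, hfy2⟩ := hf y hy
    rw [← hfe] at hfy2
    exact hb z h3 (markedAt_of_mem_markedBlocks hfx (by omega) (by omega))
  refine Finset.card_le_card_of_injOn f (fun x hx => ?_) (fun x hx y hy hxy => ?_)
  · simp only [Finset.mem_coe, mem_positions, Set.Finite.mem_toFinset] at *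
    exact (hf x hx).1
  · simp only [Finset.mem_coe, mem_positions] at *
    by_contra hne
    rcases lt_or_gt_of_ne hne with h | h
    · exact hlt x y h hx hy hxy
    · exact hlt y x h hy hx hxy.symm

theorem lt_of_mem_block {b : ℕ × ℕ} (hb : b ∈ markedBlocks m) {x y z : ℕ}
    (hx : b.1 ≤ x ∧ x ≤ b.2) (hy : b.1 ≤ y ∧ y ≤ b.2) (hz : ¬ MarkedAt m z) (h : x < z) : y < z := by
  by_contra! hzy
  exact hz (markedAt_of_mem_markedBlocks hb (by omega) (by omega))

theorem gt_of_mem_block {b : ℕ × ℕ} (hb : b ∈ markedBlocks m) {x y z : ℕ}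
    (hx : b.1 ≤ x ∧ x ≤ b.2) (hy : b.1 ≤ y ∧ y ≤ b.2) (hz : ¬ MarkedAt m z) (h : z < x) : z < y := by
  by_contra! hzy
  exact hz (markedAt_of_mem_markedBlocks hb (by omega) (by omega))

/-- Marked letters which meet the same marked blocks alternate with the same unmarked letters. -/
theorem alternate_of_blocksOf_eq [DecidableEq α] {a b c d : α}
    (hma : ∀ x : ℕ, w[x]? = some a → MarkedAt m x)
    (hmb : ∀ x : ℕ, w[x]? = some b → MarkedAt m x)
    (hmc : ∀ x : ℕ, w[x]? = some c → ¬ MarkedAt m x)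
    (hmd : ∀ x : ℕ, w[x]? = some d → ¬ MarkedAt m x)
    (hab : blocksOf m w a = blocksOf m w b) (hac : Alternate w a c) (hbd : Alternate w b d) :
    Alternate w b c := by
  have hblock : ∀ {a b : α}, (∀ x : ℕ, w[x]? = some a → MarkedAt m x) →
      blocksOf m w a = blocksOf m w b → ∀ x : ℕ, w[x]? = some a → ∃ e ∈ markedBlocks m,
      (e.1 ≤ x ∧ x ≤ e.2) ∧ ∃ y : ℕ, (e.1 ≤ y ∧ y ≤ e.2) ∧ w[y]? = some b := by
    intro a b hma hab x hx
    obtain ⟨e, he, h1, h2⟩ := exists_markedBlock (hma x hx)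
    have : e ∈ blocksOf m w b := hab ▸ ⟨he, x, h1, h2, hx⟩
    obtain ⟨-, y, h3, h4, h5⟩ := this
    exact ⟨e, he, ⟨h1, h2⟩, y, ⟨h3, h4⟩, h5⟩
  rw [alternate_iff] at *
  obtain ⟨-, -, hc, hac1, hac2⟩ := hac
  obtain ⟨-, hb, -, hbd1, -⟩ := hbd
  refine ⟨?_, hb, hc, ?_, ?_⟩
  · rintro rfl
    obtain ⟨x, hx⟩ := List.mem_iff_getElem?.1 hb
    exact hmc x hx (hmb x hx)
  -- An unmarked `d` between two `b`s puts them in different blocks. These blocks also hold `a`s in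
  -- the same order; the unmarked `c` between those `a`s lies outside both blocks, hence between the
  -- `b`s.
  · intro x y hxy hx hy
    obtain ⟨z, hz1, hz2, hz⟩ := hbd1 x y hxy hx hy
    obtain ⟨e, he, hex, x', hex', hx'⟩ := hblock hmb hab.symm x hx
    obtain ⟨f, hf, hfy, y', hfy', hy'⟩ := hblock hmb hab.symm y hy
    have h1 := lt_of_mem_block he hex hex' (hmd z hz) hz1
    have h2 := gt_of_mem_block hf hfy hfy' (hmd z hz) hz2
    obtain ⟨v, hv1, hv2, hv⟩ := hac1 x' y' (by omega) hx' hy'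
    exact ⟨v, lt_of_mem_block he hex' hex (hmc v hv) hv1,
      gt_of_mem_block hf hfy' hfy (hmc v hv) hv2, hv⟩
  -- The block of an `a` between two unmarked `c`s lies wholly between them, and it contains a `b`.
  · intro x y hxy hx hy
    obtain ⟨z, hz1, hz2, hz⟩ := hac2 x y hxy hx hy
    obtain ⟨e, he, hez, z', hez', hz'⟩ := hblock hma hab z hz
    exact ⟨z', gt_of_mem_block he hez hez' (hmc x hx) hz1,
      lt_of_mem_block he hez hez' (hmc y hy) hz2, hz'⟩

/-- The word in which every letter is written twice in a row. -/
def doubled (l : List α) : List α := l.flatMap fun x => [x, x]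

theorem mem_doubled {l : List α} {a : α} : a ∈ doubled l ↔ a ∈ l := by
  simp [doubled]

theorem markedAt_markedVersion [DecidableEq α] {σ w : List α} {i j : ℕ} {a : α}
    (h : w[j]? = some a) : MarkedAt (markedVersion σ w i) j ↔ a ∈ σ.take i := by
  simp [MarkedAt, markedVersion, h]

end Blocks

/-! ### The inclusion of classes. -/

section Inclusion

variable {α : Type u} [DecidableEq α]

theorem count_le_of_isLocal {w : List α} {k : ℕ} (hw : IsLocal k w) {a b : α}
    (hab : Alternate w a b) : w.count a ≤ k + 1 := by
  obtain ⟨σ, hσ, hk⟩ := hw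
  have key : ∀ a b, Alternate w a b → σ.idxOf a < σ.idxOf b → w.count a ≤ k := by
    intro a b hab hlt
    have hab' := alternate_iff.1 hab
    have ha := (hσ.2 a).2 hab'.2.1
    have hb := (hσ.2 b).2 hab'.2.2.1
    refine count_le_of_separates_unmarked
      (hk (σ.idxOf a + 1) (by omega) (List.idxOf_lt_length_iff.2 ha)) (fun x hx => ?_)
      (fun x hx => ?_) hab'.2.2.2.1
    · rw [markedAt_markedVersion hx, List.mem_take_iff_idxOf_lt ha]
      omega
    · rw [markedAt_markedVersion hx, List.mem_take_iff_idxOf_lt hb]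
      omega
  have hab' := alternate_iff.1 hab
  rcases lt_trichotomy (σ.idxOf a) (σ.idxOf b) with h | h | h
  · exact (key a b hab h).trans (Nat.le_succ k)
  · exact absurd ((List.idxOf_inj ((hσ.2 a).2 hab'.2.1)).1 h) hab'.1
  · have h1 := key b a hab.symm h
    have h2 := count_le_succ_of_separates hab'.1.symm hab'.2.2.2.1
    omega

theorem count_doubled (l : List α) (a : α) : (doubled l).count a = 2 * l.count a := by
  induction l with
  | nil => simp [doubled]
  | cons c l ih =>
    have : doubled (c :: l) = [c, c] ++ doubled l := by simp [doubled]
    rw [this, List.count_append, ih]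
    by_cases h : c = a
    · subst h
      simp
      ring
    · simp [h]

theorem not_alternate_append_doubled {v l : List α} {a b : α} (ha : a ∈ l) :
    ¬ Alternate (v ++ doubled l) a b := by
  rw [alternate_iff_isChain]
  rintro ⟨-, -, -, hc⟩
  obtain ⟨s, t, rfl⟩ := List.append_of_mem ha
  have : v ++ doubled (s ++ a :: t) = (v ++ doubled s) ++ ([a, a] ++ doubled t) := by
    simp [doubled]
  rw [this, proj_append, proj_append] at hc
  have h : (proj [a, a] a b ++ proj (doubled t) a b).IsChain (· ≠ ·) :=
    proj_append [a, a] (doubled t) a b ▸ hc.right_of_append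
  have h := h.left_of_append
  simp [proj] at h

/-- The isolated nodes can be made to occur at most twice, without changing the other letters. -/
theorem exists_represents_count_le {w : List α} {G : SimpleGraph α} {c : ℕ} (hc : 2 ≤ c)
    (hw : Represents w G) (hcount : ∀ a b, G.Adj a b → w.count a ≤ c) :
    ∃ v, Represents v G ∧ ∀ a, v.count a ≤ c := by
  classical
  set I : α → Prop := fun a => ∀ b, ¬ G.Adj a b with hI
  -- The factor `aa` prevents an isolated `a` from alternating with anything and costs two
  -- occurrences, whence `2 ≤ c`.
  set v := w.filter (fun a => ¬ I a) ++ doubled (w.dedup.filter (fun a => I a)) with hv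
  have hiso : ∀ a b, I a → ¬ Alternate v a b := fun a b ha =>
    not_alternate_append_doubled (by simp [hw.1 a, ha])
  refine ⟨v, ⟨fun a => ?_, fun a b => ?_⟩, fun a => ?_⟩
  · by_cases ha : I a
    · simp [hv, mem_doubled, hw.1 a, ha]
    · simp [hv, hw.1 a, ha]
  · by_cases ha : I a
    · exact iff_of_false (hiso a b ha) (ha b)
    · by_cases hb : I b
      · exact iff_of_false (fun h => hiso b a hb h.symm) (fun h => hb a h.symm)
      · have h2 : proj (doubled (w.dedup.filter (fun a => I a))) a b = [] := by
          rw [proj, List.filter_eq_nil_iff]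
          intro x hx
          have hx := (mem_doubled.1 hx)
          simp only [List.mem_filter, decide_eq_true_eq] at hx ⊢
          rintro (rfl | rfl)
          · exact ha hx.2
          · exact hb hx.2
        have h1 : proj (w.filter (fun a => ¬ I a)) a b = proj w a b := by
          rw [proj, proj, List.filter_filter]
          refine List.filter_congr fun x _ => ?_
          simp only [← Bool.decide_and, decide_eq_decide, and_iff_left_iff_imp]
          rintro (rfl | rfl)
          · exact ha
          · exact hb
        have h : proj v a b = proj w a b := by rw [hv, proj_append, h1, h2, List.append_nil]
        rw [← hw.2]
        simp only [Alternate, h]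
  · rw [hv, List.count_append, count_doubled]
    by_cases ha : I a
    · have h1 : (w.filter (fun a => ¬ I a)).count a = 0 := by
        rw [List.count_eq_zero]
        simp [ha]
      have h2 : (w.dedup.filter (fun a => I a)).count a ≤ 1 :=
        List.nodup_iff_count_le_one.1 (w.nodup_dedup.filter _) a
      omega
    · have h2 : (w.dedup.filter (fun a => I a)).count a = 0 := by
        rw [List.count_eq_zero]
        simp [ha]
      have h1 : (w.filter (fun a => ¬ I a)).count a ≤ w.count a :=
        List.filter_sublist.count_le a
      obtain ⟨b, hb⟩ := not_forall_not.1 ha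
      have := hcount a b hb
      omega

theorem locClass_subset_repClass {k : ℕ} (hk : 1 ≤ k) :
    LocClass.{u} k ⊆ RepClass.{u} (k + 1) := by
  classical
  rintro G ⟨w, hl, hw⟩
  have := G.finite
  obtain ⟨v, hv, hc⟩ := exists_represents_count_le (c := k + 1) (by omega) hw
    (fun a b hab => count_le_of_isLocal hl ((hw.2 a b).2 hab))
  exact exists_uniform_of_count_le hv hc

end Inclusion

/-! ### The tree graphs and strictness of the inclusion. -/

section Separation

/-- The leaves of the complete ternary tree of height `n`. -/
def Leaf : ℕ → Type u
  | 0 => PUnit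
  | n + 1 => Fin 3 × Leaf n

theorem finite_leaf : ∀ n, Finite (Leaf.{u} n)
  | 0 => inferInstanceAs (Finite PUnit)
  | n + 1 =>
    have := finite_leaf n
    inferInstanceAs (Finite (Fin 3 × Leaf n))

/-- The leaves `x` and `y` branch at depth `j`, and `x` is to the left of `y`. -/
def LeftOf : ∀ n : ℕ, ℕ → Leaf.{u} n → Leaf.{u} n → Prop
  | 0, _, _, _ => False
  | _ + 1, 0, x, y => x.1 < y.1
  | n + 1, j + 1, x, y => x.1 = y.1 ∧ LeftOf n j x.2 y.2

/-- The leaves listed by a traversal of the tree that goes from left to right at the depths `j`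
with `d j = true` and from right to left at the other depths. -/
def traversal : ∀ n : ℕ, (ℕ → Bool) → List (Leaf.{u} n)
  | 0, _ => [PUnit.unit]
  | n + 1, d => (if d 0 then [0, 1, 2] else [2, 1, 0]).flatMap fun i : Fin 3 =>
      (traversal n fun j => d (j + 1)).map (Prod.mk i)

theorem mem_traversal : ∀ (n : ℕ) (d : ℕ → Bool) (x : Leaf.{u} n), x ∈ traversal n d
  | 0, _, x => by
    obtain rfl : x = PUnit.unit := rfl
    exact List.mem_singleton.2 rfl
  | n + 1, d, (i, x) => by
    refine List.mem_flatMap.2 ⟨i, ?_, List.mem_map_of_mem (mem_traversal n _ x)⟩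
    split_ifs <;> fin_cases i <;> simp

theorem nodup_traversal : ∀ (n : ℕ) (d : ℕ → Bool), (traversal.{u} n d).Nodup
  | 0, _ => List.nodup_singleton _
  | n + 1, d => by
    refine List.nodup_flatMap.2 ⟨fun i _ => ?_, ?_⟩
    · exact (nodup_traversal n _).map (Prod.mk_right_injective i)
    · have h : (if d 0 then [0, 1, 2] else [2, 1, 0] : List (Fin 3)).Nodup := by
        split_ifs <;> decide
      refine h.imp fun {i j} hij => ?_
      intro x hx hy
      obtain ⟨_, _, rfl⟩ := List.mem_map.1 hx
      obtain ⟨_, _, h⟩ := List.mem_map.1 hy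
      exact hij (congrArg Prod.fst h).symm

theorem pair_sublist_flatMap {ι β : Type*} {l : List ι} {f : ι → List β} {i j : ι} {x y : β}
    (h : [i, j].Sublist l) (hx : x ∈ f i) (hy : y ∈ f j) : [x, y].Sublist (l.flatMap f) := by
  have h1 : ([i, j].flatMap f).Sublist (l.flatMap f) := h.flatMap f
  refine List.Sublist.trans ?_ h1
  have h2 := (List.singleton_sublist.2 hx).append (List.singleton_sublist.2 hy)
  simpa using h2

/-- Above depth `j` both leaves lie in the same subtree, so only the direction `d j` decides which
is visited first. -/
theorem LeftOf.sublist_traversal : ∀ {n j : ℕ} {x y : Leaf.{u} n} {d : ℕ → Bool}, LeftOf n j x y →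
    (d j = true → [x, y].Sublist (traversal n d)) ∧ (d j = false → [y, x].Sublist (traversal n d))
  | 0, _, _, _, _, h => h.elim
  | n + 1, 0, (a, x), (b, y), d, h => by
    have h' : a < b := h
    have hm : ∀ (i : Fin 3) (x : Leaf n),
        (i, x) ∈ (traversal n fun j => d (j + 1)).map (Prod.mk i) :=
      fun i x => List.mem_map_of_mem (mem_traversal n _ x)
    constructor <;> intro hd <;> refine pair_sublist_flatMap ?_ (hm _ _) (hm _ _) <;> rw [hd] <;>
      clear h hm hd <;> revert a b <;> decide
  | n + 1, j + 1, (a, x), (b, y), d, h => by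
    obtain ⟨rfl, h⟩ : a = b ∧ LeftOf n j x y := h
    have hm : a ∈ (if d 0 then [0, 1, 2] else [2, 1, 0] : List (Fin 3)) := by
      split_ifs <;> fin_cases a <;> simp
    have hs : ((traversal n fun j => d (j + 1)).map (Prod.mk a)).Sublist (traversal (n + 1) d) := by
      have := (List.singleton_sublist.2 hm).flatMap
        fun i : Fin 3 => (traversal n fun j => d (j + 1)).map (Prod.mk i)
      rw [List.flatMap_singleton] at this
      exact this
    have ih := LeftOf.sublist_traversal (d := fun j => d (j + 1)) h
    exact ⟨fun hd => ((ih.1 hd).map (Prod.mk a)).trans hs,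
      fun hd => ((ih.2 hd).map (Prod.mk a)).trans hs⟩

theorem LeftOf.ne : ∀ {n j : ℕ} {x y : Leaf.{u} n}, LeftOf n j x y → x ≠ y
  | 0, _, _, _, h => h.elim
  | _ + 1, 0, _, _, h => fun hxy => (ne_of_lt h) (congrArg Prod.fst hxy)
  | _ + 1, _ + 1, _, _, h => fun hxy => h.2.ne (congrArg Prod.snd hxy)

/-- The leaves `x` and `y` branch at depth `j`. -/
def BranchAt (n j : ℕ) (x y : Leaf.{u} n) : Prop := LeftOf n j x y ∨ LeftOf n j y x

theorem branchAt_zero {n : ℕ} {x y : Leaf.{u} (n + 1)} : BranchAt (n + 1) 0 x y ↔ x.1 ≠ y.1 := by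
  change x.1 < y.1 ∨ y.1 < x.1 ↔ _
  exact ne_iff_lt_or_gt.symm

theorem branchAt_succ {n j : ℕ} {x y : Leaf.{u} (n + 1)} :
    BranchAt (n + 1) (j + 1) x y ↔ x.1 = y.1 ∧ BranchAt n j x.2 y.2 := by
  change (x.1 = y.1 ∧ LeftOf n j x.2 y.2) ∨ (y.1 = x.1 ∧ LeftOf n j y.2 x.2) ↔ _
  rw [BranchAt, eq_comm (a := y.1)]
  tauto

theorem BranchAt.symm {n j : ℕ} {x y : Leaf.{u} n} (h : BranchAt n j x y) : BranchAt n j y x :=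
  Or.symm h

/-- At depth `i` the leaf `y` still follows `p`, so `x` leaves both there. -/
theorem BranchAt.trans : ∀ {n i j : ℕ} {x y p : Leaf.{u} n}, i < j → BranchAt n i p x →
    BranchAt n j p y → BranchAt n i x y
  | 0, _, _, _, _, _, _, h, _ => h.elim (fun h => h.elim) (fun h => h.elim)
  | n + 1, 0, j + 1, x, y, p, _, hx, hy => by
    rw [branchAt_zero] at hx ⊢
    rw [branchAt_succ] at hy
    rw [← hy.1]
    exact hx.symm
  | n + 1, i + 1, j + 1, x, y, p, hij, hx, hy => by
    rw [branchAt_succ] at *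
    exact ⟨hx.1.symm.trans hy.1, hx.2.trans (by omega) hy.2⟩

/-- Every linear order on the leaves has a leaf `p` such that at every depth there are both a
smaller and a larger leaf that branch off from `p`. -/
theorem exists_leaf_between : ∀ (n : ℕ) (t : Leaf.{u} n → ℕ), Function.Injective t →
    ∃ p, ∀ j < n, ∃ x y, BranchAt n j p x ∧ BranchAt n j p y ∧ t x < t p ∧ t p < t y
  | 0, _, _ => ⟨PUnit.unit, fun _ h => absurd h (Nat.not_lt_zero _)⟩
  | n + 1, t, ht => by
    have ih := fun a : Fin 3 => exists_leaf_between n (fun x => t (a, x))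
      (ht.comp (Prod.mk_right_injective a))
    choose p hp using ih
    -- Each of the three subtrees supplies a good leaf; the middle one in the order `t` has the
    -- other two as its smaller and larger leaves at depth `0`. This is why the tree is ternary.
    obtain ⟨a, b, c, hab, hbc⟩ : ∃ a b c : Fin 3, t (a, p a) < t (b, p b) ∧
        t (b, p b) < t (c, p c) := by
      have h : ∀ a b : Fin 3, a ≠ b → t (a, p a) ≠ t (b, p b) :=
        fun a b hab h => hab (congrArg Prod.fst (ht h))
      have h01 := h 0 1 (by decide)
      have h02 := h 0 2 (by decide)
      have h12 := h 1 2 (by decide)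
      by_contra! hcon
      have h1 := hcon 0 1 2
      have h2 := hcon 0 2 1
      have h3 := hcon 1 0 2
      have h4 := hcon 1 2 0
      have h5 := hcon 2 0 1
      have h6 := hcon 2 1 0
      omega
    refine ⟨(b, p b), fun j hj => ?_⟩
    cases j with
    | zero =>
      refine ⟨(a, p a), (c, p c), ?_, ?_, hab, hbc⟩ <;> refine branchAt_zero.2 ?_
      · change b ≠ a
        rintro rfl
        exact lt_irrefl _ hab
      · change b ≠ c
        rintro rfl
        exact lt_irrefl _ hbc
    | succ j =>
      obtain ⟨x, y, hx, hy, h1, h2⟩ := hp b j (by omega)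
      exact ⟨(b, x), (b, y), branchAt_succ.2 ⟨rfl, hx⟩, branchAt_succ.2 ⟨rfl, hy⟩, h1, h2⟩

variable {α : Type u} [DecidableEq α]

theorem proj_eq_of_sublist {l : List α} {a b : α} (hl : l.Nodup) (hab : a ≠ b)
    (h : [a, b].Sublist l) : proj l a b = [a, b] := by
  have h1 : [a, b].Sublist (proj l a b) := by
    have := h.filter (fun x => decide (x = a ∨ x = b))
    simpa [proj] using this
  refine (h1.eq_of_length_le ?_).symm
  have h2 : (proj l a b).toFinset ⊆ {a, b} := by
    intro x hx
    simpa using (mem_proj.1 (List.mem_toFinset.1 hx)).2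
  have h3 := Finset.card_le_card h2
  have hn : (proj l a b).Nodup := hl.filter _
  rw [List.toFinset_card_of_nodup hn, Finset.card_pair hab] at h3
  simpa using h3

theorem alternate_append_of_sublist {l l' : List α} {a b : α} (hl : l.Nodup) (hl' : l'.Nodup)
    (hab : a ≠ b) (h : [a, b].Sublist l) (h' : [a, b].Sublist l') : Alternate (l ++ l') a b := by
  rw [alternate_iff_isChain, proj_append, proj_eq_of_sublist hl hab h,
    proj_eq_of_sublist hl' hab h']
  exact ⟨hab, List.mem_append_left _ (h.subset (by simp)),
    List.mem_append_left _ (h.subset (by simp)), by simp [hab, hab.symm]⟩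

theorem not_alternate_append_of_sublist {l l' : List α} {a b : α} (hl : l.Nodup) (hl' : l'.Nodup)
    (hab : a ≠ b) (h : [a, b].Sublist l) (h' : [b, a].Sublist l') :
    ¬ Alternate (l ++ l') a b := by
  rw [alternate_iff_isChain, proj_append, proj_eq_of_sublist hl hab h, proj_comm l',
    proj_eq_of_sublist hl' hab.symm h']
  simp

/-- The word made of the traversal from left to right and the one that changes direction at every
depth. -/
def treeWord (n : ℕ) : List (Leaf.{u} n) :=
  traversal n (fun _ => true) ++ traversal n (fun j => decide (Even j))

open Classical in
-- Each traversal lists every leaf once, so two leaves alternate iff both traversals visit them in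
-- the same order.
theorem BranchAt.alternate_treeWord {n j : ℕ} {x y : Leaf.{u} n} (h : BranchAt n j x y) :
    Alternate (treeWord n) x y ↔ Even j := by
  have key : ∀ x y : Leaf.{u} n, LeftOf n j x y → (Alternate (treeWord n) x y ↔ Even j) := by
    intro x y h
    have h1 := (h.sublist_traversal (d := fun _ => true)).1 rfl
    have h2 := h.sublist_traversal (d := fun j => decide (Even j))
    by_cases hj : Even j
    · exact iff_of_true (alternate_append_of_sublist (nodup_traversal _ _) (nodup_traversal _ _)
        h.ne h1 (h2.1 (by simpa using hj))) hj
    · exact iff_of_false (not_alternate_append_of_sublist (nodup_traversal _ _)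
        (nodup_traversal _ _) h.ne h1 (h2.2 (by simpa using hj))) hj
  rcases h with h | h
  · exact key x y h
  · rw [← key y x h]
    exact ⟨Alternate.symm, Alternate.symm⟩

open Classical in
/-- The graph represented by `treeWord n`. -/
def treeGraph (n : ℕ) : FinGraph.{u} where
  V := Leaf n
  finite := finite_leaf n
  graph :=
    { Adj := Alternate (treeWord n)
      symm := ⟨fun _ _ h => h.symm⟩
      loopless := ⟨fun _ h => h.1 rfl⟩ }

theorem treeGraph_mem_repClass (n : ℕ) {k : ℕ} (hk : 2 ≤ k) : treeGraph.{u} n ∈ RepClass k := by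
  classical
  have := finite_leaf.{u} n
  refine exists_uniform_of_count_le (α := Leaf n) (w := treeWord n)
    ⟨fun v => List.mem_append_left _ (mem_traversal n _ v), fun a b => Iff.rfl⟩ fun a => ?_
  have h1 := List.nodup_iff_count_le_one.1 (nodup_traversal n (fun _ => true)) a
  have h2 := List.nodup_iff_count_le_one.1 (nodup_traversal n (fun j => decide (Even j))) a
  rw [treeWord, List.count_append]
  omega

theorem treeGraph_notMem_locClass (k : ℕ) :
    treeGraph.{u} (2 * (2 ^ k + 1)) ∉ LocClass k := by
  classical
  set N := 2 ^ k + 1 with hN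
  rintro ⟨w, ⟨σ, hσ, hk⟩, hw⟩
  change List (Leaf (2 * N)) at w
  change List (Leaf (2 * N)) at σ
  have hmem : ∀ x, x ∈ σ := fun x => (hσ.2 x).2 (hw.1 x)
  have hadj : ∀ x y : Leaf (2 * N), Alternate w x y ↔ Alternate (treeWord (2 * N)) x y := hw.2
  obtain ⟨p, hp⟩ := exists_leaf_between (2 * N) (fun x => σ.idxOf x)
    (fun x y h => (List.idxOf_inj (hmem x)).1 h)
  -- The first stage at which `p` is marked: leaves before `p` in `σ` are marked, those after it are
  -- not.
  set M := markedVersion σ w (σ.idxOf p + 1) with hM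
  have hblocks := hk (σ.idxOf p + 1) (by omega) (List.idxOf_lt_length_iff.2 (hmem p))
  have hx : ∀ i : Fin N, ∃ x, BranchAt (2 * N) (2 * i) p x ∧ σ.idxOf x < σ.idxOf p := by
    intro i
    obtain ⟨x, y, h1, h2, h3, h4⟩ := hp (2 * i) (by omega)
    exact ⟨x, h1, h3⟩
  have hy : ∀ i : Fin N, ∃ y, BranchAt (2 * N) (2 * i + 1) p y ∧ σ.idxOf p < σ.idxOf y := by
    intro i
    obtain ⟨x, y, h1, h2, h3, h4⟩ := hp (2 * i + 1) (by omega)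
    exact ⟨y, h2, h4⟩
  choose x hxp hxt using hx
  choose y hyp hyt using hy
  have hmx : ∀ i, ∀ z : ℕ, w[z]? = some (x i) → MarkedAt M z := by
    intro i z hz
    rw [hM, markedAt_markedVersion hz, List.mem_take_iff_idxOf_lt (hmem _)]
    have := hxt i
    omega
  have hmy : ∀ i, ∀ z : ℕ, w[z]? = some (y i) → ¬ MarkedAt M z := by
    intro i z hz
    rw [hM, markedAt_markedVersion hz, List.mem_take_iff_idxOf_lt (hmem _)]
    have := hyt i
    omega
  have halt : ∀ i j : Fin N, i ≤ j → Alternate w (x i) (y j) := by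
    intro i j hij
    have hij' : (i : ℕ) ≤ j := hij
    rw [hadj, ((hxp i).trans (by omega) (hyp j)).alternate_treeWord]
    exact even_two_mul _
  have hnalt : ∀ i j : Fin N, j < i → ¬ Alternate w (x i) (y j) := by
    intro i j hij
    have hij' : (j : ℕ) < i := hij
    rw [hadj, ((hyp j).trans (by omega) (hxp i)).symm.alternate_treeWord]
    simp
  have hfin := markedBlocks_finite M
  have hsub : ∀ i, blocksOf M w (x i) ⊆ markedBlocks M := fun i b hb => hb.1
  obtain ⟨i, -, j, -, hne, heq⟩ : ∃ i ∈ (Finset.univ : Finset (Fin N)), ∃ j ∈ Finset.univ,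
      i ≠ j ∧ (hfin.subset (hsub i)).toFinset = (hfin.subset (hsub j)).toFinset := by
    -- Pigeonhole: `2 ^ k + 1` leaves `x i`, but at most `2 ^ k` sets of marked blocks.
    refine Finset.exists_ne_map_eq_of_card_lt_of_maps_to (t := hfin.toFinset.powerset) ?_ ?_
    · rw [Finset.card_powerset, ← Set.ncard_eq_toFinset_card _ hfin, Finset.card_univ,
        Fintype.card_fin]
      refine Nat.lt_succ_of_le ?_
      exact Nat.pow_le_pow_right (by norm_num) hblocks
    · intro i _
      simpa using hsub i
  have hcontra : ∀ i j : Fin N, i < j → blocksOf M w (x i) = blocksOf M w (x j) → False := by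
    intro i j hij h
    -- The edges from `x i` to `y i` and from `x j` to `y j` would force the missing edge from `x j`
    -- to `y i`.
    exact hnalt j i hij (alternate_of_blocksOf_eq (hmx i) (hmx j) (hmy i) (hmy j) h
      (halt i i le_rfl) (halt j j le_rfl))
  have heq' : blocksOf M w (x i) = blocksOf M w (x j) := by simpa using heq
  rcases lt_or_gt_of_ne hne with h | h
  · exact hcontra i j h heq'
  · exact hcontra j i h heq'.symm

end Separation

end WordGraph

theorem mainTheorem2 (k : ℕ) (hk : 1 ≤ k) :
    WordGraph.LocClass k ⊂ WordGraph.RepClass (k + 1) := by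
  refine ⟨WordGraph.locClass_subset_repClass hk, fun h => ?_⟩
  exact WordGraph.treeGraph_notMem_locClass k (h (WordGraph.treeGraph_mem_repClass _ (by omega)))
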